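/- All Hilbert spaces are complex, and $B(H,K)$ is the space of bounded operators $H\to K$. For a set $\mathcal X$ of operators, $[\mathcal X]$ denotes the weak* (ultraweak) closure of the linear span of $\mathcal X$. A masa on $H$ is a maximal abelian selfadjoint subalgebra of $B(H)$. Let $\mathcal D_1,\mathcal D_2$ be masas on $H_1,H_2$. A linear subspace $\mathcal U\subset B(H_1,H_2)$ is a bimodule over $\mathcal D_1,\mathcal D_2$ if $\mathcal D_2\,\mathcal U\,\mathcal D_1\subset\mathcal U$. It is nondegenerate if $\mathcal U(H_1)$ spans a dense subspace of $H_2$ and $\mathcal U^*(H_2)$ spans a dense subspace of $H_1$, and it is reflexive if $$\mathcal U=\{T\in B(H_1,H_2): T\xi\in\overline{\mathrm{span}(\mathcal U\xi)}\ \text{ for all } \xi\in H_1\}.$$ Let $\mathcal U_1\subset B(H_1,H_2)$ be a nondegenerate bimodule over masas $\mathcal D_1,\mathcal D_2$ on $H_1,H_2$, and let $\mathcal U_2\subset B(K_1,K_2)$ be a nondegenerate bimodule over masas $\mathcal E_1,\mathcal E_2$ on $K_1,K_2$. They are called spatially Morita equivalent (over these masas) if there are linear subspaces $$\mathcal V_1\subset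 B(H_1,K_1),\quad \mathcal V_2\subset B(H_2,K_2),\quad \mathcal W_1\subset B(K_1,H_1),\quad \mathcal W_2\subset B(K_2,H_2)$$ that are bimodules over the same masas (that is, $\mathcal E_i\mathcal V_i\mathcal D_i\subset\mathcal V_i$ and $\mathcal D_i\mathcal W_i\mathcal E_i\subset\mathcal W_i$ for $i=1,2$) such that (i) $\mathcal U_1=[\mathcal W_2\,\mathcal U_2\,\mathcal V_1]$ and $\mathcal U_2=[\mathcal V_2\,\mathcal U_1\,\mathcal W_1]$, and (ii) each of $[\mathcal V_1\mathcal W_1]$, $[\mathcal W_1\mathcal V_1]$, $[\mathcal V_2\mathcal W_2]$, $[\mathcal W_2\mathcal V_2]$ is an algebra that contains the identity operator. **Corollary.** Spatial Morita equivalence is an equivalence relation on nondegenerate reflexive masa bimodules. This holds in both of the following senses: (a) for nondegenerate reflexive bimodules, each given together with the two masas over which it is a bimodule, with the relation taken over these masas; (b) for nondegenerate reflexive spaces of operators that are bimodules over some pair of masas, with the masas not part of the data, where two such spaces are related if they are bimodules over, and spatially Morita equivalent over, some choice of masas on the four Hilbert spaces. -/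

import Mathlib

/-! Operators between complex Hilbert spaces; `H →L[ℂ] K` is `B(H, K)`. -/

namespace MasaBimod

section Basic

variable {H : Type*} [NormedAddCommGroup H] [InnerProductSpace ℂ H]
variable {K : Type*} [NormedAddCommGroup K] [InnerProductSpace ℂ K]

/-- The normal functional `T ↦ ∑ₙ ⟪yₙ, T xₙ⟫` on `B(H, K)` given by square summable sequences
`x` in `H` and `y` in `K`. These are exactly the functionals `T ↦ tr (T ω)`, `ω` trace class. -/
noncomputable def normalFunctional
    (p : lp (fun _ : ℕ => H) 2 × lp (fun _ : ℕ => K) 2) (T : H →L[ℂ] K) : ℂ :=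
  ∑' n, inner ℂ (p.2 n) (T (p.1 n))

/-- The series that defines `normalFunctional` always converges. -/
theorem summable_normalFunctional
    (p : lp (fun _ : ℕ => H) 2 × lp (fun _ : ℕ => K) 2) (T : H →L[ℂ] K) :
    Summable fun n => inner ℂ (p.2 n) (T (p.1 n)) := by
  have h1 : Summable fun n => ‖p.1 n‖ ^ 2 := by
    simpa using (lp.memℓp p.1).summable (by norm_num)
  have h2 : Summable fun n => ‖p.2 n‖ ^ 2 := by
    simpa using (lp.memℓp p.2).summable (by norm_num)
  refine Summable.of_norm_bounded ((h2.add h1).mul_left ‖T‖) fun n => ?_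
  have h3 := norm_inner_le_norm (𝕜 := ℂ) (p.2 n) (T (p.1 n))
  have h4 := T.le_opNorm (p.1 n)
  have h5 : ‖p.2 n‖ * ‖T (p.1 n)‖ ≤ ‖p.2 n‖ * (‖T‖ * ‖p.1 n‖) :=
    mul_le_mul_of_nonneg_left h4 (norm_nonneg _)
  have h6 : ‖p.2 n‖ * ‖p.1 n‖ ≤ ‖p.2 n‖ ^ 2 + ‖p.1 n‖ ^ 2 := by
    nlinarith [sq_nonneg (‖p.2 n‖ - ‖p.1 n‖), sq_nonneg ‖p.2 n‖, sq_nonneg ‖p.1 n‖]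
  have h7 := mul_le_mul_of_nonneg_left h6 (norm_nonneg T)
  nlinarith

/-- The weak* (ultraweak) topology of `B(H, K)`, as the dual of the trace class operators:
the weakest topology that makes all normal functionals continuous. -/
noncomputable abbrev weakStarTopology (H : Type*) [NormedAddCommGroup H] [InnerProductSpace ℂ H]
    (K : Type*) [NormedAddCommGroup K] [InnerProductSpace ℂ K] :
    TopologicalSpace (H →L[ℂ] K) :=
  TopologicalSpace.induced
    (fun T (p : lp (fun _ : ℕ => H) 2 × lp (fun _ : ℕ => K) 2) => normalFunctional p T)
    Pi.topologicalSpace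

/-- `[X]`: the weak* closure of the linear span of a set `X` of operators. -/
noncomputable def wspan (X : Set (H →L[ℂ] K)) : Set (H →L[ℂ] K) :=
  @closure _ (weakStarTopology H K) (Submodule.span ℂ X : Set (H →L[ℂ] K))

/-- The reflexive hull of a set of operators. -/
def refHull (U : Set (H →L[ℂ] K)) : Set (H →L[ℂ] K) :=
  {T | ∀ ξ : H, T ξ ∈ closure (Submodule.span ℂ {y : K | ∃ S ∈ U, S ξ = y} : Set K)}

/-- A space of operators is reflexive if it is equal to its reflexive hull. -/
def IsReflexive (U : Submodule ℂ (H →L[ℂ] K)) : Prop :=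
  refHull (U : Set (H →L[ℂ] K)) = U

/-- A set of operators on `H` is a unital algebra: it is a linear subspace, it is closed under
products, and it contains the identity operator of `H`. -/
def IsUnitalAlgebra (A : Set (H →L[ℂ] H)) : Prop :=
  ∃ B : Subalgebra ℂ (H →L[ℂ] H), (B : Set (H →L[ℂ] H)) = A

end Basic

section Products

variable {H₁ H₂ H₃ H₄ : Type*}
  [NormedAddCommGroup H₁] [InnerProductSpace ℂ H₁] [NormedAddCommGroup H₂]
  [InnerProductSpace ℂ H₂] [NormedAddCommGroup H₃] [InnerProductSpace ℂ H₃]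
  [NormedAddCommGroup H₄] [InnerProductSpace ℂ H₄]

/-- The set `X Y` of all products `S T`, `S ∈ X`, `T ∈ Y`. -/
def prod₂ (X : Submodule ℂ (H₂ →L[ℂ] H₃)) (Y : Submodule ℂ (H₁ →L[ℂ] H₂)) :
    Set (H₁ →L[ℂ] H₃) :=
  {R | ∃ S ∈ X, ∃ T ∈ Y, R = S.comp T}

/-- The set `X Y Z` of all products `S T R`, `S ∈ X`, `T ∈ Y`, `R ∈ Z`. -/
def prod₃ (X : Submodule ℂ (H₃ →L[ℂ] H₄)) (Y : Submodule ℂ (H₂ →L[ℂ] H₃))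
    (Z : Submodule ℂ (H₁ →L[ℂ] H₂)) : Set (H₁ →L[ℂ] H₄) :=
  {Q | ∃ S ∈ X, ∃ T ∈ Y, ∃ R ∈ Z, Q = S.comp (T.comp R)}

end Products

section Masa

variable {H : Type*} [NormedAddCommGroup H] [InnerProductSpace ℂ H] [CompleteSpace H]
variable {K : Type*} [NormedAddCommGroup K] [InnerProductSpace ℂ K] [CompleteSpace K]

/-- A maximal abelian selfadjoint subalgebra (masa) of `B(H)`. -/
def IsMasa (D : StarSubalgebra ℂ (H →L[ℂ] H)) : Prop :=
  Maximal (fun S : StarSubalgebra ℂ (H →L[ℂ] H) => ∀ A ∈ S, ∀ B ∈ S, A * B = B * A) D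

/-- `U ⊆ B(H, K)` is a bimodule over `D ⊆ B(H)` and `E ⊆ B(K)`: `E U D ⊆ U`. -/
def IsBimodule (D : StarSubalgebra ℂ (H →L[ℂ] H)) (E : StarSubalgebra ℂ (K →L[ℂ] K))
    (U : Submodule ℂ (H →L[ℂ] K)) : Prop :=
  ∀ B ∈ E, ∀ T ∈ U, ∀ A ∈ D, B.comp (T.comp A) ∈ U

/-- `U(H)` spans a dense subspace of `K`, and `U*(K)` spans a dense subspace of `H`. -/
def IsNondegenerate (U : Submodule ℂ (H →L[ℂ] K)) : Prop :=
  Dense (Submodule.span ℂ {y : K | ∃ T ∈ U, ∃ ξ : H, T ξ = y} : Set K) ∧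
  Dense (Submodule.span ℂ {x : H | ∃ T ∈ U, ∃ η : K, ContinuousLinearMap.adjoint T η = x} : Set H)

end Masa

section Morita

variable {H₁ H₂ K₁ K₂ : Type*}
  [NormedAddCommGroup H₁] [InnerProductSpace ℂ H₁] [CompleteSpace H₁]
  [NormedAddCommGroup H₂] [InnerProductSpace ℂ H₂] [CompleteSpace H₂]
  [NormedAddCommGroup K₁] [InnerProductSpace ℂ K₁] [CompleteSpace K₁]
  [NormedAddCommGroup K₂] [InnerProductSpace ℂ K₂] [CompleteSpace K₂]

/-- Spatial Morita equivalence of `U₁ ⊆ B(H₁, H₂)` and `U₂ ⊆ B(K₁, K₂)`, with respect to the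
masas `D₁, D₂, E₁, E₂` acting on `H₁, H₂, K₁, K₂`. -/
def SpatiallyMoritaEquivalent
    (D₁ : StarSubalgebra ℂ (H₁ →L[ℂ] H₁)) (D₂ : StarSubalgebra ℂ (H₂ →L[ℂ] H₂))
    (E₁ : StarSubalgebra ℂ (K₁ →L[ℂ] K₁)) (E₂ : StarSubalgebra ℂ (K₂ →L[ℂ] K₂))
    (U₁ : Submodule ℂ (H₁ →L[ℂ] H₂)) (U₂ : Submodule ℂ (K₁ →L[ℂ] K₂)) : Prop :=
  ∃ (V₁ : Submodule ℂ (H₁ →L[ℂ] K₁)) (V₂ : Submodule ℂ (H₂ →L[ℂ] K₂))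
    (W₁ : Submodule ℂ (K₁ →L[ℂ] H₁)) (W₂ : Submodule ℂ (K₂ →L[ℂ] H₂)),
    (IsBimodule D₁ E₁ V₁ ∧ IsBimodule D₂ E₂ V₂ ∧ IsBimodule E₁ D₁ W₁ ∧ IsBimodule E₂ D₂ W₂) ∧
    ((U₁ : Set (H₁ →L[ℂ] H₂)) = wspan (prod₃ W₂ U₂ V₁) ∧
      (U₂ : Set (K₁ →L[ℂ] K₂)) = wspan (prod₃ V₂ U₁ W₁)) ∧
    (IsUnitalAlgebra (wspan (prod₂ V₁ W₁)) ∧ IsUnitalAlgebra (wspan (prod₂ W₁ V₁)) ∧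
      IsUnitalAlgebra (wspan (prod₂ V₂ W₂)) ∧ IsUnitalAlgebra (wspan (prod₂ W₂ V₂)))

end Morita

universe u v

/-- A linear space `U ⊆ B(H₁, H₂)` of operators between Hilbert spaces. -/
structure OperatorSpace where
  H₁ : Type u
  H₂ : Type v
  [normed₁ : NormedAddCommGroup H₁]
  [inner₁ : InnerProductSpace ℂ H₁]
  [complete₁ : CompleteSpace H₁]
  [normed₂ : NormedAddCommGroup H₂]
  [inner₂ : InnerProductSpace ℂ H₂]
  [complete₂ : CompleteSpace H₂]
  U : Submodule ℂ (H₁ →L[ℂ] H₂)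

attribute [instance] OperatorSpace.normed₁ OperatorSpace.inner₁ OperatorSpace.complete₁
  OperatorSpace.normed₂ OperatorSpace.inner₂ OperatorSpace.complete₂

/-- A nondegenerate reflexive masa bimodule, together with the masas over which it is a
bimodule. -/
structure ReflexiveMasaBimodule extends OperatorSpace.{u, v} where
  D₁ : StarSubalgebra ℂ (H₁ →L[ℂ] H₁)
  D₂ : StarSubalgebra ℂ (H₂ →L[ℂ] H₂)
  masa₁ : IsMasa D₁
  masa₂ : IsMasa D₂
  bimodule : IsBimodule D₁ D₂ U
  nondegenerate : IsNondegenerate U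
  reflexive : IsReflexive U

/-- Spatial Morita equivalence of masa bimodules over their given masas. -/
def ReflexiveMasaBimodule.Equivalent (X Y : ReflexiveMasaBimodule.{u, v}) : Prop :=
  SpatiallyMoritaEquivalent X.D₁ X.D₂ Y.D₁ Y.D₂ X.U Y.U

/-- A nondegenerate reflexive space of operators that is a bimodule over some masas, where the
masas are not part of the data. -/
structure ReflexiveMasaBimoduleSpace extends OperatorSpace.{u, v} where
  exists_masas : ∃ (D₁ : StarSubalgebra ℂ (H₁ →L[ℂ] H₁)) (D₂ : StarSubalgebra ℂ (H₂ →L[ℂ] H₂)),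
    IsMasa D₁ ∧ IsMasa D₂ ∧ IsBimodule D₁ D₂ U
  nondegenerate : IsNondegenerate U
  reflexive : IsReflexive U

/-- Spatial Morita equivalence with respect to some choice of masas. -/
def ReflexiveMasaBimoduleSpace.Equivalent (X Y : ReflexiveMasaBimoduleSpace.{u, v}) : Prop :=
  ∃ (D₁ : StarSubalgebra ℂ (X.H₁ →L[ℂ] X.H₁)) (D₂ : StarSubalgebra ℂ (X.H₂ →L[ℂ] X.H₂))
    (E₁ : StarSubalgebra ℂ (Y.H₁ →L[ℂ] Y.H₁)) (E₂ : StarSubalgebra ℂ (Y.H₂ →L[ℂ] Y.H₂)),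
    (IsMasa D₁ ∧ IsMasa D₂ ∧ IsMasa E₁ ∧ IsMasa E₂) ∧
    (IsBimodule D₁ D₂ X.U ∧ IsBimodule E₁ E₂ Y.U) ∧
    SpatiallyMoritaEquivalent D₁ D₂ E₁ E₂ X.U Y.U

end MasaBimod

/-! Transitivity is the issue. When two contexts are composed, the middle contributes the algebras
`[V₁ W₁]` and `[W₁' V₁']`, both attached to `U₂` but possibly different, and the masas chosen for
`U₂` may differ as well. The remedy is a canonical choice: every context can be enlarged so that its
four algebras become the full multiplier algebras, `𝓡 Uᵢ = {T | Uᵢ T ⊆ Uᵢ}` on the right and `𝓛 Uᵢ =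
{T | T Uᵢ ⊆ Uᵢ}` on the left.

The enlargement replaces `V₁` by `[𝓡 U₂ V₁]`, `W₁` by `[𝓡 U₁ W₁]`, and similarly `V₂`, `W₂` with
`𝓛`. It works because `W₁ 𝓡 U₂ V₁ ⊆ 𝓡 U₁` (`wmul_rightMultipliers_wmul_le`, with its left-hand
mirror image).

Full contexts do not mention masas and compose by cancelling the middle algebra
(`FullyEquivalent.trans`). Any masas over which `U₁`, `U₂` are bimodules lie in the multiplier
algebras, so the bimodule conditions come back for free. Hence both relations coincide with
`FullyEquivalent`. Reflexive spaces are weak* closed, which makes the multiplier algebras themselves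
a context from `U` to itself. -/

namespace MasaBimod

/-! ### Weak* closed sets and separate weak* continuity of multiplication -/

section WeakStar

variable {H K L M : Type*}
  [NormedAddCommGroup H] [InnerProductSpace ℂ H]
  [NormedAddCommGroup K] [InnerProductSpace ℂ K]
  [NormedAddCommGroup L] [InnerProductSpace ℂ L]
  [NormedAddCommGroup M] [InnerProductSpace ℂ M]

/-- The normal functionals, as one linear map into a product of copies of `ℂ`. -/
noncomputable def normalFunctionals (H K : Type*) [NormedAddCommGroup H] [InnerProductSpace ℂ H]
    [NormedAddCommGroup K] [InnerProductSpace ℂ K] :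
    (H →L[ℂ] K) →ₗ[ℂ] (lp (fun _ : ℕ => H) 2 × lp (fun _ : ℕ => K) 2 → ℂ) where
  toFun T p := normalFunctional p T
  map_add' S T := by
    funext p
    simp only [normalFunctional, Pi.add_apply, add_apply, inner_add_right]
    exact (summable_normalFunctional p S).tsum_add (summable_normalFunctional p T)
  map_smul' c T := by
    funext p
    simp only [normalFunctional, Pi.smul_apply, smul_apply, inner_smul_right,
      RingHom.id_apply, smul_eq_mul]
    exact tsum_mul_left

/-- A set of operators is weak* closed. -/
def IsWeakStarClosed (X : Set (H →L[ℂ] K)) : Prop :=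
  @IsClosed _ (weakStarTopology H K) X

/-- The closure of a submodule in the topology induced by a linear map. -/
def inducedClosure {E F : Type*} [AddCommGroup E] [Module ℂ E] [AddCommGroup F] [Module ℂ F]
    [TopologicalSpace F] [IsTopologicalAddGroup F] [ContinuousSMul ℂ F] (f : E →ₗ[ℂ] F)
    (S : Submodule ℂ E) : Submodule ℂ E :=
  letI : TopologicalSpace E := TopologicalSpace.induced f inferInstance
  haveI : IsTopologicalAddGroup E := topologicalAddGroup_induced f
  haveI : ContinuousSMul ℂ E := continuousSMul_induced f
  S.topologicalClosure

/-- `wspan X` as a submodule. -/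
noncomputable def wspanSubmodule (X : Set (H →L[ℂ] K)) : Submodule ℂ (H →L[ℂ] K) :=
  inducedClosure (normalFunctionals H K) (Submodule.span ℂ X)

/-- `weakStarTopology` is by definition induced by the linear map `normalFunctionals`, so both sides
are the same closure. -/
theorem coe_wspanSubmodule (X : Set (H →L[ℂ] K)) :
    (wspanSubmodule X : Set (H →L[ℂ] K)) = wspan X := rfl

theorem isWeakStarClosed_wspan (X : Set (H →L[ℂ] K)) : IsWeakStarClosed (wspan X) :=
  @isClosed_closure _ (weakStarTopology H K) _

theorem subset_wspan (X : Set (H →L[ℂ] K)) : X ⊆ wspan X :=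
  Submodule.subset_span.trans (@subset_closure _ (weakStarTopology H K) _)

theorem wspanSubmodule_le {X : Set (H →L[ℂ] K)} {S : Submodule ℂ (H →L[ℂ] K)}
    (hS : IsWeakStarClosed (S : Set (H →L[ℂ] K))) (h : X ⊆ S) : wspanSubmodule X ≤ S :=
  @closure_minimal _ (weakStarTopology H K) _ _ (Submodule.span_le.2 h) hS

/-- Apply a bounded operator to every term of a square summable sequence. -/
noncomputable def lpMap (A : H →L[ℂ] K) (x : lp (fun _ : ℕ => H) 2) : lp (fun _ : ℕ => K) 2 :=
  ⟨fun n => A (x n), by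
    have h : Summable fun n => ‖x n‖ ^ 2 := by
      simpa using (lp.memℓp x).summable (by norm_num)
    refine memℓp_gen ?_
    refine Summable.of_nonneg_of_le (fun n => by positivity) (fun n => ?_)
      (h.mul_left (‖A‖ ^ 2))
    have := pow_le_pow_left₀ (norm_nonneg _) (A.le_opNorm (x n)) 2
    simpa [mul_pow] using this⟩

theorem isWeakStarClosed_forall {ι : Sort*} {X : ι → Set (H →L[ℂ] K)}
    (h : ∀ i, IsWeakStarClosed (X i)) : IsWeakStarClosed {T | ∀ i, T ∈ X i} := by
  rw [Set.ofPred_forall]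
  exact @isClosed_iInter _ _ (weakStarTopology H K) _ h

theorem continuous_normalFunctional (p : lp (fun _ : ℕ => H) 2 × lp (fun _ : ℕ => K) 2) :
    @Continuous _ _ (weakStarTopology H K) _ (fun T : H →L[ℂ] K => normalFunctional p T) :=
  @Continuous.comp _ _ _ (weakStarTopology H K) _ _
    (fun (T : H →L[ℂ] K) (p : lp (fun _ : ℕ => H) 2 × lp (fun _ : ℕ => K) 2) =>
      normalFunctional p T) _ (continuous_apply p) continuous_induced_dom

variable [CompleteSpace L] [CompleteSpace M]

/-- Two-sided multiplication pulls normal functionals back to normal functionals; this gives its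
weak* continuity. -/
theorem normalFunctional_comp (p : lp (fun _ : ℕ => H) 2 × lp (fun _ : ℕ => M) 2)
    (A : L →L[ℂ] M) (T : K →L[ℂ] L) (B : H →L[ℂ] K) :
    normalFunctional p (A.comp (T.comp B)) =
      normalFunctional (lpMap B p.1, lpMap (ContinuousLinearMap.adjoint A) p.2) T := by
  simp only [normalFunctional, lpMap, ContinuousLinearMap.comp_apply]
  exact tsum_congr fun n => (ContinuousLinearMap.adjoint_inner_left A _ _).symm

theorem continuous_comp_comp (A : L →L[ℂ] M) (B : H →L[ℂ] K) :
    @Continuous _ _ (weakStarTopology K L) (weakStarTopology H M)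
      (fun T : K →L[ℂ] L => A.comp (T.comp B)) := by
  let := weakStarTopology K L
  refine continuous_induced_rng.2 (continuous_pi fun p => ?_)
  simp only [Function.comp_def, normalFunctional_comp]
  exact continuous_normalFunctional _

theorem IsWeakStarClosed.preimage_comp_comp {X : Set (H →L[ℂ] M)} (hX : IsWeakStarClosed X)
    (A : L →L[ℂ] M) (B : H →L[ℂ] K) :
    IsWeakStarClosed {T : K →L[ℂ] L | A.comp (T.comp B) ∈ X} :=
  @IsClosed.preimage _ _ (weakStarTopology K L) (weakStarTopology H M) _
    (continuous_comp_comp A B) _ hX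

theorem IsWeakStarClosed.preimage_comp_left {X : Set (K →L[ℂ] M)} (hX : IsWeakStarClosed X)
    (A : L →L[ℂ] M) : IsWeakStarClosed {T : K →L[ℂ] L | A.comp T ∈ X} := by
  simpa using hX.preimage_comp_comp A (ContinuousLinearMap.id ℂ K)

theorem IsWeakStarClosed.preimage_comp_right {X : Set (H →L[ℂ] L)} (hX : IsWeakStarClosed X)
    (B : H →L[ℂ] K) : IsWeakStarClosed {T : K →L[ℂ] L | T.comp B ∈ X} := by
  simpa using hX.preimage_comp_comp (ContinuousLinearMap.id ℂ L) B

theorem isWeakStarClosed_inner_eq_zero (x : H) (y : K) :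
    IsWeakStarClosed {T : H →L[ℂ] K | inner ℂ y (T x) = 0} := by
  -- A vector functional is the normal functional of two sequences with a single nonzero term.
  have h : ∀ T : H →L[ℂ] K, normalFunctional (lp.single 2 0 x, lp.single 2 0 y) T =
      inner ℂ y (T x) := by
    intro T
    rw [normalFunctional, tsum_eq_single 0]
    · simp
    · intro n hn
      simp [lp.single_apply, Pi.single_eq_of_ne hn]
  have := continuous_normalFunctional (lp.single (E := fun _ : ℕ => H) 2 0 x,
    lp.single (E := fun _ : ℕ => K) 2 0 y)
  simp only [h] at this
  exact @IsClosed.preimage _ _ (weakStarTopology H K) _ _ this {0} isClosed_singleton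

theorem isWeakStarClosed_refHull [CompleteSpace K] (X : Set (H →L[ℂ] K)) :
    IsWeakStarClosed (refHull X) := by
  refine isWeakStarClosed_forall fun ξ => ?_
  set N := Submodule.span ℂ {y : K | ∃ S ∈ X, S ξ = y}
  -- Since `Nᗮᗮ` is the closure of `N`, membership amounts to the vanishing of vector functionals.
  have h : {T : H →L[ℂ] K | T ξ ∈ closure (N : Set K)} =
      {T | ∀ y : Nᗮ, T ∈ {T : H →L[ℂ] K | inner ℂ (y : K) (T ξ) = 0}} := by
    ext T
    have : T ξ ∈ closure (N : Set K) ↔ T ξ ∈ Nᗮᗮ := by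
      rw [Submodule.orthogonal_orthogonal_eq_closure]; rfl
    simp only [Set.mem_ofPred_eq, this, Submodule.mem_orthogonal _ (T ξ), Subtype.forall]
  change IsWeakStarClosed {T : H →L[ℂ] K | T ξ ∈ closure (N : Set K)}
  rw [h]
  exact isWeakStarClosed_forall fun y => isWeakStarClosed_inner_eq_zero ξ _

end WeakStar

/-! ### The weak* closed product and multiplier algebras -/

section Product

set_option linter.unusedSectionVars false

variable {H K L M : Type*}
  [NormedAddCommGroup H] [InnerProductSpace ℂ H] [CompleteSpace H]
  [NormedAddCommGroup K] [InnerProductSpace ℂ K] [CompleteSpace K]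
  [NormedAddCommGroup L] [InnerProductSpace ℂ L] [CompleteSpace L]
  [NormedAddCommGroup M] [InnerProductSpace ℂ M] [CompleteSpace M]

/-- The weak* closed product `[X Y]`. -/
noncomputable def wmul (X : Submodule ℂ (K →L[ℂ] L)) (Y : Submodule ℂ (H →L[ℂ] K)) :
    Submodule ℂ (H →L[ℂ] L) :=
  wspanSubmodule (prod₂ X Y)

local infixr:70 " ⊙ " => wmul

theorem isWeakStarClosed_wmul (X : Submodule ℂ (K →L[ℂ] L)) (Y : Submodule ℂ (H →L[ℂ] K)) :
    IsWeakStarClosed (X ⊙ Y : Set (H →L[ℂ] L)) :=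
  isWeakStarClosed_wspan _

theorem comp_mem_wmul {X : Submodule ℂ (K →L[ℂ] L)} {Y : Submodule ℂ (H →L[ℂ] K)}
    {S : K →L[ℂ] L} {T : H →L[ℂ] K} (hS : S ∈ X) (hT : T ∈ Y) : S.comp T ∈ X ⊙ Y :=
  subset_wspan _ ⟨S, hS, T, hT, rfl⟩

theorem wmul_le {X : Submodule ℂ (K →L[ℂ] L)} {Y : Submodule ℂ (H →L[ℂ] K)}
    {Z : Submodule ℂ (H →L[ℂ] L)} (hZ : IsWeakStarClosed (Z : Set (H →L[ℂ] L)))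
    (h : ∀ S ∈ X, ∀ T ∈ Y, S.comp T ∈ Z) : X ⊙ Y ≤ Z :=
  wspanSubmodule_le hZ (by rintro _ ⟨S, hS, T, hT, rfl⟩; exact h S hS T hT)

theorem wmul_mono {X X' : Submodule ℂ (K →L[ℂ] L)} {Y Y' : Submodule ℂ (H →L[ℂ] K)}
    (hX : X ≤ X') (hY : Y ≤ Y') : X ⊙ Y ≤ X' ⊙ Y' :=
  wmul_le (isWeakStarClosed_wmul _ _) fun _ hS _ hT => comp_mem_wmul (hX hS) (hY hT)

/-- A left multiplication that sends `X` into the closed space `Z` sends `[X]` into `Z`. -/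
theorem comp_left_mem_of_mem_wspanSubmodule {X : Set (H →L[ℂ] K)} {Z : Submodule ℂ (H →L[ℂ] L)}
    (hZ : IsWeakStarClosed (Z : Set (H →L[ℂ] L))) {A : K →L[ℂ] L}
    (h : ∀ T ∈ X, A.comp T ∈ Z) {T : H →L[ℂ] K} (hT : T ∈ wspanSubmodule X) : A.comp T ∈ Z :=
  wspanSubmodule_le (S := Z.comap ((ContinuousLinearMap.compL ℂ H K L A).toLinearMap))
    (hZ.preimage_comp_left A) h hT

/-- A right multiplication that sends `X` into the closed space `Z` sends `[X]` into `Z`. -/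
theorem comp_right_mem_of_mem_wspanSubmodule {X : Set (K →L[ℂ] L)} {Z : Submodule ℂ (H →L[ℂ] L)}
    (hZ : IsWeakStarClosed (Z : Set (H →L[ℂ] L))) {A : H →L[ℂ] K}
    (h : ∀ T ∈ X, T.comp A ∈ Z) {T : K →L[ℂ] L} (hT : T ∈ wspanSubmodule X) : T.comp A ∈ Z :=
  wspanSubmodule_le (S := Z.comap (((ContinuousLinearMap.compL ℂ H K L).flip A).toLinearMap))
    (hZ.preimage_comp_right A) h hT

/-- Separate continuity suffices: with the outer factor fixed, an element of the inner closed
product may be replaced by a plain product. -/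
theorem wmul_assoc (X : Submodule ℂ (L →L[ℂ] M)) (Y : Submodule ℂ (K →L[ℂ] L))
    (Z : Submodule ℂ (H →L[ℂ] K)) : (X ⊙ Y) ⊙ Z = X ⊙ Y ⊙ Z := by
  apply le_antisymm
  · refine wmul_le (isWeakStarClosed_wmul _ _) fun S hS T hT => ?_
    refine comp_right_mem_of_mem_wspanSubmodule (isWeakStarClosed_wmul _ _) ?_ hS
    rintro _ ⟨A, hA, B, hB, rfl⟩
    exact comp_mem_wmul hA (comp_mem_wmul hB hT)
  · refine wmul_le (isWeakStarClosed_wmul _ _) fun S hS T hT => ?_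
    refine comp_left_mem_of_mem_wspanSubmodule (isWeakStarClosed_wmul _ _) ?_ hT
    rintro _ ⟨A, hA, B, hB, rfl⟩
    exact comp_mem_wmul (comp_mem_wmul hS hA) hB

theorem wspanSubmodule_prod₃ (X : Submodule ℂ (L →L[ℂ] M)) (Y : Submodule ℂ (K →L[ℂ] L))
    (Z : Submodule ℂ (H →L[ℂ] K)) : wspanSubmodule (prod₃ X Y Z) = X ⊙ Y ⊙ Z := by
  apply le_antisymm
  · refine wspanSubmodule_le (isWeakStarClosed_wmul _ _) ?_
    rintro _ ⟨A, hA, B, hB, C, hC, rfl⟩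
    exact comp_mem_wmul hA (comp_mem_wmul hB hC)
  · refine wmul_le (isWeakStarClosed_wspan _) fun S hS T hT => ?_
    refine comp_left_mem_of_mem_wspanSubmodule (isWeakStarClosed_wspan _) ?_ hT
    rintro _ ⟨A, hA, B, hB, rfl⟩
    exact subset_wspan _ ⟨S, hS, A, hA, B, hB, rfl⟩

theorem coe_eq_wspan_prod₃_iff {X : Submodule ℂ (L →L[ℂ] M)} {Y : Submodule ℂ (K →L[ℂ] L)}
    {Z : Submodule ℂ (H →L[ℂ] K)} {U : Submodule ℂ (H →L[ℂ] M)} :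
    (U : Set (H →L[ℂ] M)) = wspan (prod₃ X Y Z) ↔ U = X ⊙ Y ⊙ Z := by
  rw [← coe_wspanSubmodule, wspanSubmodule_prod₃, SetLike.coe_set_eq]

theorem le_wmul_left {A : Submodule ℂ (K →L[ℂ] K)} (hA : 1 ∈ A) (X : Submodule ℂ (H →L[ℂ] K)) :
    X ≤ A ⊙ X :=
  fun _ hT => comp_mem_wmul (S := 1) hA hT

theorem le_wmul_right {A : Submodule ℂ (H →L[ℂ] H)} (hA : 1 ∈ A) (X : Submodule ℂ (H →L[ℂ] K)) :
    X ≤ X ⊙ A :=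
  fun _ hT => comp_mem_wmul (T := 1) hT hA

theorem IsUnitalAlgebra.one_mem {X : Submodule ℂ (K →L[ℂ] H)} {Y : Submodule ℂ (H →L[ℂ] K)}
    (h : IsUnitalAlgebra (wspan (prod₂ X Y))) : 1 ∈ X ⊙ Y := by
  obtain ⟨B, hB⟩ := h
  change 1 ∈ wspan (prod₂ X Y)
  rw [← hB]
  exact B.one_mem

theorem IsUnitalAlgebra.wmul_self_le {X : Submodule ℂ (K →L[ℂ] H)}
    {Y : Submodule ℂ (H →L[ℂ] K)} (h : IsUnitalAlgebra (wspan (prod₂ X Y))) :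
    (X ⊙ Y) ⊙ (X ⊙ Y) ≤ X ⊙ Y := by
  obtain ⟨B, hB⟩ := h
  refine wmul_le (isWeakStarClosed_wmul _ _) fun S hS T hT => ?_
  change _ ∈ wspan (prod₂ X Y)
  change S ∈ wspan (prod₂ X Y) at hS
  change T ∈ wspan (prod₂ X Y) at hT
  rw [← hB] at *
  exact B.mul_mem hS hT

/-- The operators `T` with `U T ⊆ U`. -/
def rightMultipliers (U : Submodule ℂ (H →L[ℂ] K)) : Subalgebra ℂ (H →L[ℂ] H) where
  carrier := {T | ∀ S ∈ U, S.comp T ∈ U}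
  mul_mem' := fun hA hB S hS => hB _ (hA S hS)
  add_mem' := fun hA hB S hS => by
    rw [ContinuousLinearMap.comp_add]; exact U.add_mem (hA S hS) (hB S hS)
  algebraMap_mem' := fun c S hS => by
    rw [Algebra.algebraMap_eq_smul_one, ContinuousLinearMap.comp_smul]
    exact U.smul_mem c hS

/-- The operators `T` with `T U ⊆ U`. -/
def leftMultipliers (U : Submodule ℂ (H →L[ℂ] K)) : Subalgebra ℂ (K →L[ℂ] K) where
  carrier := {T | ∀ S ∈ U, T.comp S ∈ U}
  mul_mem' := fun hA hB S hS => hA _ (hB S hS)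
  add_mem' := fun hA hB S hS => by
    rw [ContinuousLinearMap.add_comp]; exact U.add_mem (hA S hS) (hB S hS)
  algebraMap_mem' := fun c S hS => by
    rw [Algebra.algebraMap_eq_smul_one, ContinuousLinearMap.smul_comp]
    exact U.smul_mem c hS

local notation "𝓡" U:max => Subalgebra.toSubmodule (rightMultipliers U)
local notation "𝓛" U:max => Subalgebra.toSubmodule (leftMultipliers U)

variable {U : Submodule ℂ (H →L[ℂ] K)}

theorem isWeakStarClosed_rightMultipliers (hU : IsWeakStarClosed (U : Set (H →L[ℂ] K))) :
    IsWeakStarClosed (𝓡 U : Set (H →L[ℂ] H)) :=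
  isWeakStarClosed_forall fun S => isWeakStarClosed_forall fun _ => hU.preimage_comp_left S

theorem isWeakStarClosed_leftMultipliers (hU : IsWeakStarClosed (U : Set (H →L[ℂ] K))) :
    IsWeakStarClosed (𝓛 U : Set (K →L[ℂ] K)) :=
  isWeakStarClosed_forall fun S => isWeakStarClosed_forall fun _ => hU.preimage_comp_right S

theorem le_rightMultipliers {X : Submodule ℂ (H →L[ℂ] H)} (h : U ⊙ X ≤ U) : X ≤ 𝓡 U :=
  fun _ hT _ hS => h (comp_mem_wmul hS hT)

theorem le_leftMultipliers {X : Submodule ℂ (K →L[ℂ] K)} (h : X ⊙ U ≤ U) : X ≤ 𝓛 U :=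
  fun _ hT _ hS => h (comp_mem_wmul hT hS)

theorem wmul_rightMultipliers (hU : IsWeakStarClosed (U : Set (H →L[ℂ] K))) : U ⊙ 𝓡 U = U :=
  le_antisymm (wmul_le hU fun _ hS _ hT => hT _ hS)
    (le_wmul_right (rightMultipliers U).one_mem U)

theorem leftMultipliers_wmul (hU : IsWeakStarClosed (U : Set (H →L[ℂ] K))) : 𝓛 U ⊙ U = U :=
  le_antisymm (wmul_le hU fun _ hS _ hT => hS _ hT)
    (le_wmul_left (leftMultipliers U).one_mem U)

theorem rightMultipliers_wmul_self (hU : IsWeakStarClosed (U : Set (H →L[ℂ] K))) :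
    𝓡 U ⊙ 𝓡 U = 𝓡 U :=
  le_antisymm (wmul_le (isWeakStarClosed_rightMultipliers hU) fun _ hS _ hT =>
    (rightMultipliers U).mul_mem hS hT) (le_wmul_left (rightMultipliers U).one_mem _)

theorem leftMultipliers_wmul_self (hU : IsWeakStarClosed (U : Set (H →L[ℂ] K))) :
    𝓛 U ⊙ 𝓛 U = 𝓛 U :=
  le_antisymm (wmul_le (isWeakStarClosed_leftMultipliers hU) fun _ hS _ hT =>
    (leftMultipliers U).mul_mem hS hT) (le_wmul_left (leftMultipliers U).one_mem _)

theorem IsBimodule.mem_rightMultipliers {D : StarSubalgebra ℂ (H →L[ℂ] H)}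
    {E : StarSubalgebra ℂ (K →L[ℂ] K)} (h : IsBimodule D E U) {A : H →L[ℂ] H} (hA : A ∈ D) :
    A ∈ 𝓡 U :=
  fun T hT => h 1 E.one_mem T hT A hA

theorem IsBimodule.mem_leftMultipliers {D : StarSubalgebra ℂ (H →L[ℂ] H)}
    {E : StarSubalgebra ℂ (K →L[ℂ] K)} (h : IsBimodule D E U) {B : K →L[ℂ] K} (hB : B ∈ E) :
    B ∈ 𝓛 U :=
  fun T hT => h B hB T hT 1 D.one_mem

end Product

/-! ### Full Morita contexts -/

section Context

set_option linter.unusedSectionVars false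

variable {H₁ H₂ K₁ K₂ L₁ L₂ : Type*}
  [NormedAddCommGroup H₁] [InnerProductSpace ℂ H₁] [CompleteSpace H₁]
  [NormedAddCommGroup H₂] [InnerProductSpace ℂ H₂] [CompleteSpace H₂]
  [NormedAddCommGroup K₁] [InnerProductSpace ℂ K₁] [CompleteSpace K₁]
  [NormedAddCommGroup K₂] [InnerProductSpace ℂ K₂] [CompleteSpace K₂]
  [NormedAddCommGroup L₁] [InnerProductSpace ℂ L₁] [CompleteSpace L₁]
  [NormedAddCommGroup L₂] [InnerProductSpace ℂ L₂] [CompleteSpace L₂]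

local infixr:70 " ⊙ " => wmul
local notation "𝓡" U:max => Subalgebra.toSubmodule (rightMultipliers U)
local notation "𝓛" U:max => Subalgebra.toSubmodule (leftMultipliers U)

/-- A Morita context whose four algebras are the full multiplier algebras of `U₁` and `U₂`.
No masas are involved. -/
structure IsFullContext (U₁ : Submodule ℂ (H₁ →L[ℂ] H₂)) (U₂ : Submodule ℂ (K₁ →L[ℂ] K₂))
    (V₁ : Submodule ℂ (H₁ →L[ℂ] K₁)) (V₂ : Submodule ℂ (H₂ →L[ℂ] K₂))
    (W₁ : Submodule ℂ (K₁ →L[ℂ] H₁)) (W₂ : Submodule ℂ (K₂ →L[ℂ] H₂)) : Prop where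
  left_eq : U₁ = W₂ ⊙ U₂ ⊙ V₁
  right_eq : U₂ = V₂ ⊙ U₁ ⊙ W₁
  V₁_W₁ : V₁ ⊙ W₁ = 𝓡 U₂
  W₁_V₁ : W₁ ⊙ V₁ = 𝓡 U₁
  V₂_W₂ : V₂ ⊙ W₂ = 𝓛 U₂
  W₂_V₂ : W₂ ⊙ V₂ = 𝓛 U₁
  R_V₁ : 𝓡 U₂ ⊙ V₁ = V₁
  R_W₁ : 𝓡 U₁ ⊙ W₁ = W₁
  V₂_L : V₂ ⊙ 𝓛 U₁ = V₂
  W₂_L : W₂ ⊙ 𝓛 U₂ = W₂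

/-- Existence of a full context. -/
def FullyEquivalent (U₁ : Submodule ℂ (H₁ →L[ℂ] H₂)) (U₂ : Submodule ℂ (K₁ →L[ℂ] K₂)) : Prop :=
  ∃ V₁ V₂ W₁ W₂, IsFullContext U₁ U₂ V₁ V₂ W₁ W₂

variable {U₁ : Submodule ℂ (H₁ →L[ℂ] H₂)} {U₂ : Submodule ℂ (K₁ →L[ℂ] K₂)}
  {U₃ : Submodule ℂ (L₁ →L[ℂ] L₂)}
  {V₁ : Submodule ℂ (H₁ →L[ℂ] K₁)} {V₂ : Submodule ℂ (H₂ →L[ℂ] K₂)}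
  {W₁ : Submodule ℂ (K₁ →L[ℂ] H₁)} {W₂ : Submodule ℂ (K₂ →L[ℂ] H₂)}

theorem FullyEquivalent.refl (hU : IsWeakStarClosed (U₁ : Set (H₁ →L[ℂ] H₂))) :
    FullyEquivalent U₁ U₁ := by
  have hr := rightMultipliers_wmul_self hU
  have hl := leftMultipliers_wmul_self hU
  have h : U₁ = 𝓛 U₁ ⊙ U₁ ⊙ 𝓡 U₁ := by
    rw [wmul_rightMultipliers hU, leftMultipliers_wmul hU]
  exact ⟨𝓡 U₁, 𝓛 U₁, 𝓡 U₁, 𝓛 U₁, h, h, hr, hr, hl, hl, hr, hr, hl, hl⟩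

theorem FullyEquivalent.symm (h : FullyEquivalent U₁ U₂) : FullyEquivalent U₂ U₁ := by
  obtain ⟨V₁, V₂, W₁, W₂, h⟩ := h
  exact ⟨W₁, W₂, V₁, V₂, h.right_eq, h.left_eq, h.W₁_V₁, h.V₁_W₁, h.W₂_V₂, h.V₂_W₂, h.R_W₁,
    h.R_V₁, h.W₂_L, h.V₂_L⟩

/-- The middle algebra of both contexts is the same, and the neighbouring factor absorbs it: `V₁' V₁
W₁ W₁' = V₁' (𝓡 U₂) W₁' = V₁' W₁' = 𝓡 U₃`. -/
theorem FullyEquivalent.trans (h : FullyEquivalent U₁ U₂) (h' : FullyEquivalent U₂ U₃) :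
    FullyEquivalent U₁ U₃ := by
  obtain ⟨V₁, V₂, W₁, W₂, h⟩ := h
  obtain ⟨V₁', V₂', W₁', W₂', h'⟩ := h'
  refine ⟨V₁' ⊙ V₁, V₂' ⊙ V₂, W₁ ⊙ W₁', W₂ ⊙ W₂', ?_, ?_, ?_, ?_, ?_, ?_, ?_, ?_, ?_, ?_⟩
  · conv_lhs => rw [h.left_eq, h'.left_eq]
    simp only [wmul_assoc]
  · conv_lhs => rw [h'.right_eq, h.right_eq]
    simp only [wmul_assoc]
  · rw [wmul_assoc, ← wmul_assoc V₁, h.V₁_W₁, h'.R_W₁, h'.V₁_W₁]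
  · rw [wmul_assoc, ← wmul_assoc W₁', h'.W₁_V₁, h.R_V₁, h.W₁_V₁]
  · rw [wmul_assoc, ← wmul_assoc V₂, h.V₂_W₂, ← wmul_assoc, h'.V₂_L, h'.V₂_W₂]
  · rw [wmul_assoc, ← wmul_assoc W₂', h'.W₂_V₂, ← wmul_assoc, h.W₂_L, h.W₂_V₂]
  · rw [← wmul_assoc, h'.R_V₁]
  · rw [← wmul_assoc, h.R_W₁]
  · rw [wmul_assoc, h.V₂_L]
  · rw [wmul_assoc, h'.W₂_L]

/-- Substituting one formula into the other exhibits `V₁ W₁` as a right factor of `U₂`; being closed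
under products, it satisfies `U₂ V₁ W₁ ⊆ U₂`. Hence `U₁ W₁ (𝓡 U₂) V₁ = W₂ (U₂ V₁ W₁) (𝓡 U₂) V₁ ⊆ W₂
U₂ V₁ = U₁`. -/
theorem wmul_rightMultipliers_wmul_le (hU₂ : IsWeakStarClosed (U₂ : Set (K₁ →L[ℂ] K₂)))
    (h₁ : U₁ = W₂ ⊙ U₂ ⊙ V₁) (h₂ : U₂ = V₂ ⊙ U₁ ⊙ W₁)
    (h : (V₁ ⊙ W₁) ⊙ (V₁ ⊙ W₁) ≤ V₁ ⊙ W₁) : W₁ ⊙ 𝓡 U₂ ⊙ V₁ ≤ 𝓡 U₁ := by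
  have h₃ : U₂ = V₂ ⊙ W₂ ⊙ U₂ ⊙ V₁ ⊙ W₁ := by
    conv_lhs => rw [h₂, h₁]
    simp only [wmul_assoc]
  have h₄ : U₂ ⊙ V₁ ⊙ W₁ ≤ U₂ := by
    calc U₂ ⊙ V₁ ⊙ W₁ = (V₂ ⊙ W₂ ⊙ U₂ ⊙ V₁ ⊙ W₁) ⊙ V₁ ⊙ W₁ := by rw [← h₃]
      _ = V₂ ⊙ W₂ ⊙ U₂ ⊙ (V₁ ⊙ W₁) ⊙ (V₁ ⊙ W₁) := by simp only [wmul_assoc]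
      _ ≤ V₂ ⊙ W₂ ⊙ U₂ ⊙ V₁ ⊙ W₁ :=
        wmul_mono le_rfl (wmul_mono le_rfl (wmul_mono le_rfl h))
      _ = U₂ := h₃.symm
  apply le_rightMultipliers
  calc U₁ ⊙ W₁ ⊙ 𝓡 U₂ ⊙ V₁ = (W₂ ⊙ U₂ ⊙ V₁) ⊙ W₁ ⊙ 𝓡 U₂ ⊙ V₁ := by rw [← h₁]
    _ = W₂ ⊙ (U₂ ⊙ V₁ ⊙ W₁) ⊙ 𝓡 U₂ ⊙ V₁ := by simp only [wmul_assoc]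
    _ ≤ W₂ ⊙ U₂ ⊙ 𝓡 U₂ ⊙ V₁ := wmul_mono le_rfl (wmul_mono h₄ le_rfl)
    _ = U₁ := by rw [← wmul_assoc U₂, wmul_rightMultipliers hU₂, ← h₁]

theorem wmul_leftMultipliers_wmul_le (hU₂ : IsWeakStarClosed (U₂ : Set (K₁ →L[ℂ] K₂)))
    (h₁ : U₁ = W₂ ⊙ U₂ ⊙ V₁) (h₂ : U₂ = V₂ ⊙ U₁ ⊙ W₁)
    (h : (V₂ ⊙ W₂) ⊙ (V₂ ⊙ W₂) ≤ V₂ ⊙ W₂) : W₂ ⊙ 𝓛 U₂ ⊙ V₂ ≤ 𝓛 U₁ := by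
  have h₃ : U₂ = (V₂ ⊙ W₂) ⊙ U₂ ⊙ V₁ ⊙ W₁ := by
    conv_lhs => rw [h₂, h₁]
    simp only [wmul_assoc]
  have h₄ : (V₂ ⊙ W₂) ⊙ U₂ ≤ U₂ := by
    calc (V₂ ⊙ W₂) ⊙ U₂ = (V₂ ⊙ W₂) ⊙ (V₂ ⊙ W₂) ⊙ U₂ ⊙ V₁ ⊙ W₁ := by rw [← h₃]
      _ = ((V₂ ⊙ W₂) ⊙ (V₂ ⊙ W₂)) ⊙ U₂ ⊙ V₁ ⊙ W₁ := (wmul_assoc _ _ _).symm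
      _ ≤ (V₂ ⊙ W₂) ⊙ U₂ ⊙ V₁ ⊙ W₁ := wmul_mono h le_rfl
      _ = U₂ := h₃.symm
  apply le_leftMultipliers
  calc (W₂ ⊙ 𝓛 U₂ ⊙ V₂) ⊙ U₁ = (W₂ ⊙ 𝓛 U₂ ⊙ V₂) ⊙ W₂ ⊙ U₂ ⊙ V₁ := by rw [← h₁]
    _ = W₂ ⊙ 𝓛 U₂ ⊙ ((V₂ ⊙ W₂) ⊙ U₂) ⊙ V₁ := by simp only [wmul_assoc]
    _ ≤ W₂ ⊙ 𝓛 U₂ ⊙ U₂ ⊙ V₁ :=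
      wmul_mono le_rfl (wmul_mono le_rfl (wmul_mono h₄ le_rfl))
    _ = U₁ := by rw [← wmul_assoc (𝓛 U₂), leftMultipliers_wmul hU₂, ← h₁]

/-- Computes the algebras of the enlarged context, with `A` and `B` the multiplier algebras of the
two spaces. The identity lies in `X Y ⊆ X A Y`, so nothing of `B` is lost. -/
theorem wmul_wmul_eq_of_le {X : Submodule ℂ (K₁ →L[ℂ] H₁)} {Y : Submodule ℂ (H₁ →L[ℂ] K₁)}
    {A : Submodule ℂ (K₁ →L[ℂ] K₁)} {B : Submodule ℂ (H₁ →L[ℂ] H₁)}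
    (hB : B ⊙ B = B) (hA : 1 ∈ A) (h₁ : 1 ∈ X ⊙ Y) (h : X ⊙ A ⊙ Y ≤ B) :
    B ⊙ X ⊙ A ⊙ Y = B := by
  apply le_antisymm
  · exact (wmul_mono le_rfl h).trans hB.le
  · have : X ⊙ Y ≤ X ⊙ A ⊙ Y := wmul_mono le_rfl (le_wmul_left hA Y)
    exact le_wmul_right (this h₁) B

theorem wmul_wmul_eq_of_le' {X : Submodule ℂ (K₁ →L[ℂ] H₁)} {Y : Submodule ℂ (H₁ →L[ℂ] K₁)}
    {A : Submodule ℂ (K₁ →L[ℂ] K₁)} {B : Submodule ℂ (H₁ →L[ℂ] H₁)}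
    (hB : B ⊙ B = B) (hA : 1 ∈ A) (h₁ : 1 ∈ X ⊙ Y) (h : X ⊙ A ⊙ Y ≤ B) :
    X ⊙ A ⊙ Y ⊙ B = B := by
  rw [← wmul_assoc A, ← wmul_assoc X]
  apply le_antisymm
  · exact (wmul_mono h le_rfl).trans hB.le
  · have : X ⊙ Y ≤ X ⊙ A ⊙ Y := wmul_mono le_rfl (le_wmul_left hA Y)
    exact le_wmul_left (this h₁) B

theorem SpatiallyMoritaEquivalent.fullyEquivalent
    {D₁ : StarSubalgebra ℂ (H₁ →L[ℂ] H₁)} {D₂ : StarSubalgebra ℂ (H₂ →L[ℂ] H₂)}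
    {E₁ : StarSubalgebra ℂ (K₁ →L[ℂ] K₁)} {E₂ : StarSubalgebra ℂ (K₂ →L[ℂ] K₂)}
    (h : SpatiallyMoritaEquivalent D₁ D₂ E₁ E₂ U₁ U₂) : FullyEquivalent U₁ U₂ := by
  obtain ⟨V₁, V₂, W₁, W₂, -, ⟨h₁, h₂⟩, a₁, a₂, a₃, a₄⟩ := h
  rw [coe_eq_wspan_prod₃_iff] at h₁ h₂
  have c₁ : IsWeakStarClosed (U₁ : Set (H₁ →L[ℂ] H₂)) := h₁ ▸ isWeakStarClosed_wmul _ _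
  have c₂ : IsWeakStarClosed (U₂ : Set (K₁ →L[ℂ] K₂)) := h₂ ▸ isWeakStarClosed_wmul _ _
  have r₁ := rightMultipliers_wmul_self c₁
  have r₂ := rightMultipliers_wmul_self c₂
  have l₁ := leftMultipliers_wmul_self c₁
  have l₂ := leftMultipliers_wmul_self c₂
  -- Each multiplier algebra is placed next to the space that absorbs it in the formulas for `U₁`
  -- and `U₂`, so these formulas survive.
  refine ⟨𝓡 U₂ ⊙ V₁, V₂ ⊙ 𝓛 U₁, 𝓡 U₁ ⊙ W₁, W₂ ⊙ 𝓛 U₂, ?_, ?_, ?_, ?_, ?_, ?_, ?_, ?_, ?_, ?_⟩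
  · rw [wmul_assoc, ← wmul_assoc U₂, wmul_rightMultipliers c₂, ← wmul_assoc (𝓛 U₂),
      leftMultipliers_wmul c₂, ← h₁]
  · rw [wmul_assoc, ← wmul_assoc U₁, wmul_rightMultipliers c₁, ← wmul_assoc (𝓛 U₁),
      leftMultipliers_wmul c₁, ← h₂]
  · rw [wmul_assoc]
    exact wmul_wmul_eq_of_le r₂ (rightMultipliers U₁).one_mem a₁.one_mem
      (wmul_rightMultipliers_wmul_le c₁ h₂ h₁ a₂.wmul_self_le)
  · rw [wmul_assoc]
    exact wmul_wmul_eq_of_le r₁ (rightMultipliers U₂).one_mem a₂.one_mem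
      (wmul_rightMultipliers_wmul_le c₂ h₁ h₂ a₁.wmul_self_le)
  · rw [wmul_assoc]
    exact wmul_wmul_eq_of_le' l₂ (leftMultipliers U₁).one_mem a₃.one_mem
      (wmul_leftMultipliers_wmul_le c₁ h₂ h₁ a₄.wmul_self_le)
  · rw [wmul_assoc]
    exact wmul_wmul_eq_of_le' l₁ (leftMultipliers U₂).one_mem a₄.one_mem
      (wmul_leftMultipliers_wmul_le c₂ h₁ h₂ a₃.wmul_self_le)
  · rw [← wmul_assoc, r₂]
  · rw [← wmul_assoc, r₁]
  · rw [wmul_assoc, l₁]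
  · rw [wmul_assoc, l₂]

theorem isBimodule_of_wmul_eq {D : StarSubalgebra ℂ (H₁ →L[ℂ] H₁)}
    {E : StarSubalgebra ℂ (K₁ →L[ℂ] K₁)} {A : Submodule ℂ (H₁ →L[ℂ] H₁)}
    {B : Submodule ℂ (K₁ →L[ℂ] K₁)} (hA : ∀ T ∈ D, T ∈ A) (hB : ∀ T ∈ E, T ∈ B)
    (hV : V₁ ⊙ A = V₁) (hV' : B ⊙ V₁ = V₁) : IsBimodule D E V₁ := by
  intro S hS T hT R hR
  rw [← hV', ← hV]
  exact comp_mem_wmul (hB S hS) (comp_mem_wmul hT (hA R hR))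

theorem isUnitalAlgebra_wspan {X : Submodule ℂ (K₁ →L[ℂ] H₁)} {Y : Submodule ℂ (H₁ →L[ℂ] K₁)}
    {B : Subalgebra ℂ (H₁ →L[ℂ] H₁)} (h : X ⊙ Y = Subalgebra.toSubmodule B) :
    IsUnitalAlgebra (wspan (prod₂ X Y)) :=
  ⟨B, (congrArg (fun S : Submodule ℂ (H₁ →L[ℂ] H₁) => (S : Set (H₁ →L[ℂ] H₁))) h).symm⟩

theorem FullyEquivalent.spatiallyMoritaEquivalent
    {D₁ : StarSubalgebra ℂ (H₁ →L[ℂ] H₁)} {D₂ : StarSubalgebra ℂ (H₂ →L[ℂ] H₂)}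
    {E₁ : StarSubalgebra ℂ (K₁ →L[ℂ] K₁)} {E₂ : StarSubalgebra ℂ (K₂ →L[ℂ] K₂)}
    (h : FullyEquivalent U₁ U₂) (hD : IsBimodule D₁ D₂ U₁) (hE : IsBimodule E₁ E₂ U₂) :
    SpatiallyMoritaEquivalent D₁ D₂ E₁ E₂ U₁ U₂ := by
  obtain ⟨V₁, V₂, W₁, W₂, h⟩ := h
  have d₁ := fun T (hT : T ∈ D₁) => hD.mem_rightMultipliers hT
  have d₂ := fun T (hT : T ∈ D₂) => hD.mem_leftMultipliers hT
  have e₁ := fun T (hT : T ∈ E₁) => hE.mem_rightMultipliers hT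
  have e₂ := fun T (hT : T ∈ E₂) => hE.mem_leftMultipliers hT
  refine ⟨V₁, V₂, W₁, W₂, ⟨?_, ?_, ?_, ?_⟩, ⟨coe_eq_wspan_prod₃_iff.2 h.left_eq,
    coe_eq_wspan_prod₃_iff.2 h.right_eq⟩, isUnitalAlgebra_wspan h.V₁_W₁,
    isUnitalAlgebra_wspan h.W₁_V₁, isUnitalAlgebra_wspan h.V₂_W₂, isUnitalAlgebra_wspan h.W₂_V₂⟩
  -- A full context records absorption on one side only; the other side follows, as in `V₁ (𝓡 U₁) =
  -- V₁ W₁ V₁ = (𝓡 U₂) V₁ = V₁`.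
  · exact isBimodule_of_wmul_eq d₁ e₁ (by rw [← h.W₁_V₁, ← wmul_assoc, h.V₁_W₁, h.R_V₁]) h.R_V₁
  · exact isBimodule_of_wmul_eq d₂ e₂ h.V₂_L (by rw [← h.V₂_W₂, wmul_assoc, h.W₂_V₂, h.V₂_L])
  · exact isBimodule_of_wmul_eq e₁ d₁ (by rw [← h.V₁_W₁, ← wmul_assoc, h.W₁_V₁, h.R_W₁]) h.R_W₁
  · exact isBimodule_of_wmul_eq e₂ d₂ h.W₂_L (by rw [← h.W₂_V₂, wmul_assoc, h.V₂_W₂, h.W₂_L])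

theorem IsReflexive.isWeakStarClosed (h : IsReflexive U₁) :
    IsWeakStarClosed (U₁ : Set (H₁ →L[ℂ] H₂)) :=
  h ▸ isWeakStarClosed_refHull _

end Context

/-! ### Both relations expressed without masas -/

theorem ReflexiveMasaBimodule.equivalent_iff (X Y : ReflexiveMasaBimodule) :
    X.Equivalent Y ↔ FullyEquivalent X.U Y.U :=
  ⟨fun h => SpatiallyMoritaEquivalent.fullyEquivalent h,
    fun h => h.spatiallyMoritaEquivalent X.bimodule Y.bimodule⟩

/-- A full context serves every choice of masas, so masas may be picked for each space separately,
without regard to the other. -/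
theorem ReflexiveMasaBimoduleSpace.equivalent_iff (X Y : ReflexiveMasaBimoduleSpace) :
    X.Equivalent Y ↔ FullyEquivalent X.U Y.U := by
  constructor
  · rintro ⟨D₁, D₂, E₁, E₂, -, -, h⟩
    exact h.fullyEquivalent
  · intro h
    obtain ⟨D₁, D₂, hD₁, hD₂, hD⟩ := X.exists_masas
    obtain ⟨E₁, E₂, hE₁, hE₂, hE⟩ := Y.exists_masas
    exact ⟨D₁, D₂, E₁, E₂, ⟨hD₁, hD₂, hE₁, hE₂⟩, ⟨hD, hE⟩, h.spatiallyMoritaEquivalent hD hE⟩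

end MasaBimod

/-- Spatial Morita equivalence is an equivalence relation on the nondegenerate reflexive masa
bimodules, both when the masas are part of the data and when they are not. -/
theorem corollary3p7 :
    Equivalence MasaBimod.ReflexiveMasaBimodule.Equivalent ∧
      Equivalence MasaBimod.ReflexiveMasaBimoduleSpace.Equivalent := by
  constructor
  · constructor <;> simp only [MasaBimod.ReflexiveMasaBimodule.equivalent_iff]
    · exact fun X => .refl X.reflexive.isWeakStarClosed
    · exact fun h => h.symm
    · exact fun h h' => h.trans h'
  · constructor <;> simp only [MasaBimod.ReflexiveMasaBimoduleSpace.equivalent_iff]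
    · exact fun X => .refl X.reflexive.isWeakStarClosed
    · exact fun h => h.symm
    · exact fun h h' => h.trans h'
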